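/- Let $p$ be a prime and let $a,b\in\mathbb Z$. Consider lattice paths starting at $(0,0)$ with steps UP $=(1,1)$, LEVEL $=(1,0)$, DOWN $=(1,-1)$, where each UP or DOWN step has weight $a$, each LEVEL step has weight $b$, and the weight of a path is the product of the weights of its steps. Let $T^{a,b}_n$ (the generalized central trinomial coefficient) be the sum of the weights of all such paths from $(0,0)$ to $(n,0)$, and let $M^{a,b}_n$ (the generalized Motzkin number) be the sum of the weights of those among them that never go below the $x$-axis. (For $a,b\ge 0$ these are the numbers of such paths in which UP and DOWN steps carry one of $a$ colours and LEVEL steps one of $b$ colours.) The density of a residue $x\in\mathbb F_p$ in $M^{a,b}_n \bmod p$ is $\lim_{N\to\infty}\frac1N\left|\{n<N : M^{a,b}_n\equiv x \pmod p\}\right|$. All congruences below are modulo $p$. 1. If $T^{a,b}_n\equiv 0$ for some $0\le n<p$, then the density of $0$ in $M^{a,b}_n\bmod p$ exists and is $1$. 2. Suppose that $p>2$ and $T^{a,b}_n\not\equiv 0$ for all $0\le n<p$. Then the density $D_0$ of $0$ in $M^{a,b}_n\bmod p$ exists, and if $p\nmid a$, then $$D_0=\frac{\left|\{0\le n<p-2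 : M^{a,b}_n\equiv 0\}\right|}{p}+\frac{2\left|\{0\le m<p-1 : b\,T^{a,b}_m\equiv T^{a,b}_{p-1}T^{a,b}_{m+1}\}\right|}{(p-1)(p+1)}+\frac{2\left|\{0\le m<p-1 : b\,T^{a,b}_m\equiv T^{a,b}_{m+1}\}\right|}{(p-1)p(p+1)}.$$ If moreover the residues of $T^{a,b}_0,\dots,T^{a,b}_{p-1}$ generate the multiplicative group $\mathbb F_p^\times$, then every $k\in\mathbb F_p^\times$ has a density in $M^{a,b}_n\bmod p$, and it is equal to $\frac{1-D_0}{p-1}$. -/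

import Mathlib

/-- The weight of a step: `1`, `0`, `-1` stand for the steps UP, LEVEL, DOWN. There are `a` colours
for UP and for DOWN and `b` colours for LEVEL. -/
def stepWeight (a b : ℤ) (s : SignType) : ℤ := if s = 0 then b else a

/-- The weight of a lattice path with `n` steps: the product of its step weights. For `a, b ≥ 0`
this is the number of colourings of the path. -/
def pathWeight (a b : ℤ) {n : ℕ} (s : Fin n → SignType) : ℤ := ∏ i, stepWeight a b (s i)

/-- The height of the lattice path after its first `k` steps. -/
def pathHeight {n : ℕ} (s : Fin n → SignType) (k : ℕ) : ℤ :=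
  ∑ i : Fin n with i.val < k, (s i : ℤ)

/-- The generalized central trinomial coefficient: the weighted number of lattice paths from
`(0, 0)` to `(n, 0)`. -/
def centralTrinomial (a b : ℤ) (n : ℕ) : ℤ :=
  ∑ s : Fin n → SignType with pathHeight s n = 0, pathWeight a b s

/-- The generalized Motzkin number: the weighted number of lattice paths from `(0, 0)` to `(n, 0)`
that never go below the x-axis. -/
def motzkin (a b : ℤ) (n : ℕ) : ℤ :=
  ∑ s : Fin n → SignType with pathHeight s n = 0 ∧ ∀ k ≤ n, 0 ≤ pathHeight s k, pathWeight a b s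

/-- The set `S` of natural numbers has an asymptotic density, and it is equal to `d`. -/
def HasAsymptoticDensity (S : Set ℕ) (d : ℝ) : Prop :=
  Filter.Tendsto (fun N : ℕ => ((S ∩ {n | n < N}).ncard : ℝ) / (N : ℝ)) Filter.atTop (nhds d)

/-- The value `x` has density `d` in the sequence of generalized Motzkin numbers modulo `p`. -/
def MotzkinDensity (p : ℕ) (a b : ℤ) (x : ZMod p) (d : ℝ) : Prop :=
  HasAsymptoticDensity {n | (motzkin a b n : ZMod p) = x} d

/-- The explicit formula for the density of `0`. -/
noncomputable def zeroDensityFormula (p : ℕ) (a b : ℤ) : ℝ :=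
  ({n : ℕ | n < p - 2 ∧ (motzkin a b n : ZMod p) = 0}.ncard : ℝ) / p
  + 2 * ({m : ℕ | m < p - 1 ∧ (b : ZMod p) * centralTrinomial a b m =
      centralTrinomial a b (p - 1) * centralTrinomial a b (m + 1)}.ncard : ℝ)
    / (((p : ℝ) - 1) * (p + 1))
  + 2 * ({m : ℕ | m < p - 1 ∧ (b : ZMod p) * centralTrinomial a b m =
      centralTrinomial a b (m + 1)}.ncard : ℝ)
    / (((p : ℝ) - 1) * p * (p + 1))

/-!
Write `T_n(j)` for the coefficient of `T ^ j` in `(a T + b + a T⁻¹) ^ n`. The central trinomial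
coefficients are `T_n(0)`, and by the reflection principle the Motzkin numbers `M_n` are
`T_n(0) - T_n(2)`. Modulo `p` the Frobenius endomorphism makes `T_{pn+r}(0) = T_n(0) T_r(0)` and,
for `r < p - 2`, `M_{pn+r} = T_n(0) M_r`, while for the last two digits `2a² M_{pn+r}` is a linear
form in `T_n(0)` and `T_{n+1}(0)`.

If some `T_m(0)` with `m < p` vanishes, then so do `T_n(0)` and `M_n` for every `n` outside a set of
density zero, as almost every `n` has a base-`p` digit equal to `m` and, further down, a digit `0`
that is not the last one.

Otherwise let `χ` be a Dirichlet character modulo `p`. Summing over the last digit, `χ(T_n(0))` and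
the values of `χ` at linear forms in `T_n(0)` and `T_{n+1}(0)` satisfy recurrences that contract in
the mean, so their means exist and are determined by these recurrences. The linear form
`x T_{p-1}(0) T_n(0) + y T_{n+1}(0)` is turned into `x T_n(0) + y T_{n+1}(0)` and back, because
`T_{p-1}(0)² = 1`; this is the source of the factor `(p - 1)(p + 1)`. For trivial `χ` one gets the
density of `0`, and the symmetry `(b² - 4a²)^m T_{p-1-m}(0) = T_{p-1}(0) T_m(0)` identifies the
contributions of the last two digits. If the `T_m(0)` generate the unit group, the mean vanishes for
every nontrivial `χ`, and orthogonality of characters gives equidistribution.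
-/

section TrinomialCoeff

open LaurentPolynomial

variable {R : Type*} [CommRing R] (a b : R)

/-- The Laurent polynomial `a T + b + a T⁻¹`, in which a step from height `i` to height `i + j` is
recorded as `T ^ j`. -/
noncomputable def stepPolynomial : R[T;T⁻¹] := C a * T 1 + C b + C a * T (-1)

/-- The coefficient of `T ^ j` in `(a T + b + a T⁻¹) ^ n`, the weighted number of lattice paths from
`(0, 0)` to `(n, j)`. -/
noncomputable def trinomialCoeff (n : ℕ) (j : ℤ) : R := (stepPolynomial a b ^ n).coeff j

/-- The central trinomial coefficients over an arbitrary ring. -/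
noncomputable def centralCoeff (n : ℕ) : R := trinomialCoeff a b n 0

/-- The Motzkin numbers over an arbitrary ring, in the form given by the reflection principle. -/
noncomputable def motzkinCoeff (n : ℕ) : R := trinomialCoeff a b n 0 - trinomialCoeff a b n 2

theorem coeff_C_mul_T_mul (x : R) (k : ℤ) (f : R[T;T⁻¹]) (j : ℤ) :
    (C x * T k * f).coeff j = x * f.coeff (j - k) := by
  rw [← single_eq_C_mul_T, AddMonoidAlgebra.coeff_single_mul_apply, neg_add_eq_sub]

theorem coeff_trinomial_mul (x y : R) (k : ℤ) (f : R[T;T⁻¹]) (j : ℤ) :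
    ((C x * T k + C y + C x * T (-k)) * f).coeff j =
      x * f.coeff (j - k) + y * f.coeff j + x * f.coeff (j + k) := by
  have hC : (C y * f).coeff j = y * f.coeff j := by simpa using coeff_C_mul_T_mul y 0 f j
  simp only [add_mul, AddMonoidAlgebra.coeff_add, Finsupp.add_apply, coeff_C_mul_T_mul, hC,
    sub_neg_eq_add]

theorem trinomialCoeff_zero (j : ℤ) : trinomialCoeff a b 0 j = if j = 0 then 1 else 0 := by
  rw [trinomialCoeff, pow_zero, AddMonoidAlgebra.one_def, AddMonoidAlgebra.coeff_single,
    Finsupp.single_apply]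
  simp only [eq_comm]

theorem trinomialCoeff_succ (n : ℕ) (j : ℤ) :
    trinomialCoeff a b (n + 1) j = a * trinomialCoeff a b n (j - 1) + b * trinomialCoeff a b n j +
      a * trinomialCoeff a b n (j + 1) := by
  rw [trinomialCoeff, pow_succ', stepPolynomial, coeff_trinomial_mul]
  rfl

theorem trinomialCoeff_neg (n : ℕ) (j : ℤ) :
    trinomialCoeff a b n (-j) = trinomialCoeff a b n j := by
  induction n generalizing j with
  | zero => simp [trinomialCoeff_zero]
  | succ n ih =>
    rw [trinomialCoeff_succ, trinomialCoeff_succ, ← neg_add', neg_add_eq_sub, ← neg_sub j 1,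
      ih, ih, ih]
    ring

theorem trinomialCoeff_eq_zero_of_lt {n : ℕ} {j : ℤ} (h : n < |j|) :
    trinomialCoeff a b n j = 0 := by
  induction n generalizing j with
  | zero => rw [trinomialCoeff_zero, if_neg (by grind)]
  | succ n ih =>
    push_cast at h
    rw [trinomialCoeff_succ, ih (by grind), ih (by grind), ih (by grind)]
    ring

theorem map_trinomialCoeff {S : Type*} [CommRing S] (f : R →+* S) (n : ℕ) (j : ℤ) :
    f (trinomialCoeff a b n j) = trinomialCoeff (f a) (f b) n j := by
  induction n generalizing j with
  | zero => simp [trinomialCoeff_zero, apply_ite f]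
  | succ n ih => simp [trinomialCoeff_succ, ih]

theorem trinomialCoeff_zero_left (n : ℕ) {j : ℤ} (hj : j ≠ 0) : trinomialCoeff 0 b n j = 0 := by
  induction n with
  | zero => simp [trinomialCoeff_zero, hj]
  | succ n ih => simp [trinomialCoeff_succ, ih]

-- Compare coefficients in the Euler operator `T d/dT` applied to `stepPolynomial a b ^ (n + 1)`.
theorem intCast_mul_trinomialCoeff_succ (n : ℕ) (j : ℤ) :
    (j : R) * trinomialCoeff a b (n + 1) j =
      (n + 1) * a * (trinomialCoeff a b n (j - 1) - trinomialCoeff a b n (j + 1)) := by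
  induction n generalizing j with
  | zero =>
    simp only [trinomialCoeff_succ, trinomialCoeff_zero]
    by_cases hj : j = 0 ∨ j = 1 ∨ j = -1
    · rcases hj with rfl | rfl | rfl <;> simp
    · rw [if_neg (by lia), if_neg (by lia), if_neg (by lia)]
      simp
  | succ n ih =>
    have hpred := trinomialCoeff_succ a b n (j - 1)
    have hsucc := trinomialCoeff_succ a b n (j + 1)
    have ih_pred := ih (j - 1)
    have ih_succ := ih (j + 1)
    rw [trinomialCoeff_succ a b (n + 1) j]
    simp only [sub_add_cancel, add_sub_cancel_right] at hpred hsucc ih_pred ih_succ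
    push_cast at ih_pred ih_succ ⊢
    linear_combination a * ih_pred + b * ih j + a * ih_succ - (n + 1) * a * hpred +
      (n + 1) * a * hsucc

theorem centralCoeff_zero : centralCoeff a b 0 = 1 := by
  simp [centralCoeff, trinomialCoeff_zero]

theorem centralCoeff_succ (n : ℕ) :
    centralCoeff a b (n + 1) = b * centralCoeff a b n + 2 * a * trinomialCoeff a b n 1 := by
  have hsymm := trinomialCoeff_neg a b n 1
  simp only [centralCoeff, trinomialCoeff_succ, zero_sub, zero_add, hsymm]
  ring

theorem centralCoeff_one : centralCoeff a b 1 = b := by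
  simp [centralCoeff_succ, centralCoeff_zero, trinomialCoeff_zero]

theorem trinomialCoeff_succ_one (n : ℕ) :
    trinomialCoeff a b (n + 1) 1 = a * centralCoeff a b n + b * trinomialCoeff a b n 1 +
      a * trinomialCoeff a b n 2 := by
  simp [trinomialCoeff_succ, centralCoeff]

theorem two_mul_sq_mul_motzkinCoeff (n : ℕ) :
    2 * a ^ 2 * motzkinCoeff a b n = (4 * a ^ 2 - b ^ 2) * centralCoeff a b n +
      2 * b * centralCoeff a b (n + 1) - centralCoeff a b (n + 2) := by
  rw [motzkinCoeff, ← centralCoeff]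
  linear_combination centralCoeff_succ a b (n + 1) + 2 * a * trinomialCoeff_succ_one a b n -
    b * centralCoeff_succ a b n

theorem centralCoeff_recurrence (n : ℕ) :
    (n + 2) * centralCoeff a b (n + 2) = (2 * n + 3) * b * centralCoeff a b (n + 1) -
      (n + 1) * (b ^ 2 - 4 * a ^ 2) * centralCoeff a b n := by
  have heuler := intCast_mul_trinomialCoeff_succ a b n 1
  rw [Int.cast_one, one_mul, sub_self, one_add_one_eq_two, ← centralCoeff] at heuler
  linear_combination (n + 2) * centralCoeff_succ a b (n + 1) + 2 * a * heuler +
    (n + 1) * 2 * a * trinomialCoeff_succ_one a b n - (n + 1) * b * centralCoeff_succ a b n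

end TrinomialCoeff

section LatticePaths

open Finset

variable {n : ℕ} (a b : ℤ) (s : Fin n → SignType) (x : SignType)

theorem pathHeight_snoc_of_le {k : ℕ} (hk : k ≤ n) :
    pathHeight (Fin.snoc s x : Fin (n + 1) → SignType) k = pathHeight s k := by
  simp only [pathHeight, sum_filter, Fin.sum_univ_castSucc, Fin.snoc_castSucc, Fin.val_castSucc,
    Fin.val_last, if_neg hk.not_gt, add_zero]

theorem pathHeight_snoc_last :
    pathHeight (Fin.snoc s x : Fin (n + 1) → SignType) (n + 1) = pathHeight s n + x := by
  simp [pathHeight, sum_filter, Fin.sum_univ_castSucc]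

theorem pathWeight_snoc :
    pathWeight a b (Fin.snoc s x : Fin (n + 1) → SignType) =
      pathWeight a b s * stepWeight a b x := by
  simp [pathWeight, Fin.prod_univ_castSucc]

theorem nonneg_pathHeight_snoc_iff :
    (∀ k ≤ n + 1, 0 ≤ pathHeight (Fin.snoc s x : Fin (n + 1) → SignType) k) ↔
      (∀ k ≤ n, 0 ≤ pathHeight s k) ∧ 0 ≤ pathHeight s n + x := by
  rw [← pathHeight_snoc_last]
  refine ⟨fun h => ⟨fun k hk => ?_, h _ le_rfl⟩, fun h k hk => ?_⟩
  · rw [← pathHeight_snoc_of_le s x hk]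
    exact h k (by lia)
  · rcases Nat.le_succ_iff.1 hk with hk | rfl
    · rw [pathHeight_snoc_of_le s x hk]
      exact h.1 k hk
    · exact h.2

theorem sum_path_succ {M : Type*} [AddCommMonoid M] (f : (Fin (n + 1) → SignType) → M) :
    ∑ s, f s = ∑ s : Fin n → SignType,
      (f (Fin.snoc s 1) + f (Fin.snoc s 0) + f (Fin.snoc s (-1))) := by
  have sum_signType (g : SignType → M) : ∑ x, g x = g 1 + g 0 + g (-1) := by
    simp [SignType.univ_eq, add_comm, add_assoc]
  rw [← (Fin.snocEquiv fun _ : Fin (n + 1) => SignType).sum_comp, Fintype.sum_prod_type, sum_comm]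
  simp only [sum_signType]
  rfl

theorem sum_pathWeight_eq_trinomialCoeff (n : ℕ) (j : ℤ) :
    ∑ s : Fin n → SignType with pathHeight s n = j, pathWeight a b s = trinomialCoeff a b n j := by
  induction n generalizing j with
  | zero =>
    simp only [sum_filter, pathHeight, pathWeight, trinomialCoeff_zero]
    simp [eq_comm]
  | succ n ih =>
    rw [trinomialCoeff_succ, ← ih, ← ih, ← ih]
    simp only [sum_filter, sum_path_succ, pathHeight_snoc_last, pathWeight_snoc, mul_sum,
      ← sum_add_distrib]
    refine sum_congr rfl fun s _ => ?_
    simp only [stepWeight, SignType.coe_one, SignType.coe_zero, SignType.coe_neg_one, add_zero,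
      eq_sub_iff_add_eq, ← sub_eq_add_neg, sub_eq_iff_eq_add]
    norm_num [mul_comm]

/-- The sum of the weights of the lattice paths from `(0, 0)` to `(n, j)` that never go below the
`x`-axis. -/
def nonnegPathSum (n : ℕ) (j : ℤ) : ℤ :=
  ∑ s : Fin n → SignType with pathHeight s n = j ∧ ∀ k ≤ n, 0 ≤ pathHeight s k, pathWeight a b s

theorem nonnegPathSum_zero (j : ℤ) : nonnegPathSum a b 0 j = if j = 0 then 1 else 0 := by
  simp only [nonnegPathSum, sum_filter, pathHeight, pathWeight]
  simp [eq_comm]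

theorem nonnegPathSum_of_neg (n : ℕ) {j : ℤ} (hj : j < 0) : nonnegPathSum a b n j = 0 := by
  rw [nonnegPathSum, filter_eq_empty_iff.2, sum_empty]
  rintro s - ⟨hend, hnonneg⟩
  exact (hnonneg n le_rfl).not_gt (hend ▸ hj)

theorem nonnegPathSum_succ (n : ℕ) {j : ℤ} (hj : 0 ≤ j) :
    nonnegPathSum a b (n + 1) j = a * nonnegPathSum a b n (j - 1) + b * nonnegPathSum a b n j +
      a * nonnegPathSum a b n (j + 1) := by
  simp only [nonnegPathSum, sum_filter, sum_path_succ, pathHeight_snoc_last, pathWeight_snoc,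
    nonneg_pathHeight_snoc_iff, mul_sum, ← sum_add_distrib]
  refine sum_congr rfl fun s _ => ?_
  by_cases hs : ∀ k ≤ n, 0 ≤ pathHeight s k
  · have hend := hs n le_rfl
    simp only [eq_true hs, stepWeight, SignType.coe_one, SignType.coe_zero, SignType.coe_neg_one,
      one_ne_zero, if_true, if_false, true_and, and_true, (by decide : (-1 : SignType) ≠ 0)]
    grind
  · simp [hs]

theorem nonnegPathSum_eq_sub (n : ℕ) {j : ℤ} (hj : -1 ≤ j) :
    nonnegPathSum a b n j = trinomialCoeff a b n j - trinomialCoeff a b n (j + 2) := by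
  induction n generalizing j with
  | zero =>
    rw [nonnegPathSum_zero, trinomialCoeff_zero, trinomialCoeff_zero, if_neg (by lia : j + 2 ≠ 0),
      sub_zero]
  | succ n ih =>
    rcases hj.eq_or_lt with rfl | hj
    · rw [nonnegPathSum_of_neg a b _ (by lia), trinomialCoeff_neg]
      norm_num
    · rw [nonnegPathSum_succ a b n (by lia), ih (by lia), ih (by lia), ih (by lia),
        trinomialCoeff_succ, trinomialCoeff_succ]
      ring_nf

theorem motzkin_eq_motzkinCoeff (n : ℕ) : motzkin a b n = motzkinCoeff a b n :=
  nonnegPathSum_eq_sub a b n (by lia)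

variable {R : Type*} [CommRing R]

theorem intCast_centralTrinomial (n : ℕ) :
    (centralTrinomial a b n : R) = centralCoeff (a : R) (b : R) n := by
  rw [centralTrinomial, sum_pathWeight_eq_trinomialCoeff]
  exact map_trinomialCoeff a b (Int.castRingHom R) n 0

theorem intCast_motzkin (n : ℕ) : (motzkin a b n : R) = motzkinCoeff (a : R) (b : R) n := by
  rw [motzkin_eq_motzkinCoeff, motzkinCoeff, Int.cast_sub]
  exact congrArg₂ _ (map_trinomialCoeff a b (Int.castRingHom R) n 0)
    (map_trinomialCoeff a b (Int.castRingHom R) n 2)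

end LatticePaths

section Lucas

open LaurentPolynomial

theorem trinomialCoeff_prime_add {R : Type*} [CommRing R] (p : ℕ) [Fact p.Prime] [CharP R p]
    (a b : R) (n : ℕ) (j : ℤ) :
    trinomialCoeff a b (p + n) j = a ^ p * trinomialCoeff a b n (j - p) +
      b ^ p * trinomialCoeff a b n j + a ^ p * trinomialCoeff a b n (j + p) := by
  have : CharP R[T;T⁻¹] p :=
    charP_of_injective_algebraMap (FaithfulSMul.algebraMap_injective R R[T;T⁻¹]) p
  have hpow : stepPolynomial a b ^ p = C (a ^ p) * T p + C (b ^ p) + C (a ^ p) * T (-p) := by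
    rw [stepPolynomial, add_pow_char, add_pow_char, mul_pow, mul_pow, T_pow, T_pow, mul_one,
      mul_neg_one, map_pow, map_pow]
  rw [trinomialCoeff, pow_add, hpow, coeff_trinomial_mul]
  rfl

theorem trinomialCoeff_mul_add {R : Type*} [CommRing R] (p : ℕ) [Fact p.Prime] [CharP R p]
    (a b : R) (n : ℕ) {r : ℕ} (hr : r < p) (i : ℤ) {s : ℕ} (hs : s < p) :
    trinomialCoeff a b (p * n + r) (p * i + s) =
      trinomialCoeff (a ^ p) (b ^ p) n i * trinomialCoeff a b r s +
      trinomialCoeff (a ^ p) (b ^ p) n (i + 1) * trinomialCoeff a b r (s - p) := by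
  induction n generalizing i with
  | zero =>
    rw [mul_zero, zero_add, trinomialCoeff_zero, trinomialCoeff_zero]
    rcases eq_or_ne i 0 with rfl | hi
    · simp
    rcases eq_or_ne i (-1) with rfl | hi'
    · simp [sub_eq_neg_add]
    have hfar : (r : ℤ) < |(p : ℤ) * i + s| := by
      have : i ≤ -2 ∨ 1 ≤ i := by lia
      rcases this with h | h
      · have : (p : ℤ) * i ≤ p * (-2) := by gcongr
        grind
      · have : (p : ℤ) * 1 ≤ p * i := by gcongr
        grind
    rw [trinomialCoeff_eq_zero_of_lt a b hfar, if_neg hi, if_neg (by lia)]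
    ring
  | succ n ih =>
    rw [show p * (n + 1) + r = p + (p * n + r) by ring, trinomialCoeff_prime_add,
      show (p : ℤ) * i + s - p = p * (i - 1) + s by ring,
      show (p : ℤ) * i + s + p = p * (i + 1) + s by ring, ih, ih, ih, trinomialCoeff_succ,
      trinomialCoeff_succ]
    ring_nf

variable {p : ℕ} [Fact p.Prime] (a b : ZMod p)

theorem trinomialCoeff_mul_add_natCast (n : ℕ) {r : ℕ} (hr : r < p) {s : ℕ} (hs : s < p) :
    trinomialCoeff a b (p * n + r) s = centralCoeff a b n * trinomialCoeff a b r s +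
      trinomialCoeff a b n 1 * trinomialCoeff a b r (s - p) := by
  simpa [ZMod.pow_card, centralCoeff] using trinomialCoeff_mul_add p a b n hr 0 hs

theorem trinomialCoeff_mul_add_natCast_of_add_lt (n : ℕ) {r s : ℕ} (hrs : r + s < p) :
    trinomialCoeff a b (p * n + r) s = centralCoeff a b n * trinomialCoeff a b r s := by
  rw [trinomialCoeff_mul_add_natCast a b n (by lia) (by lia),
    trinomialCoeff_eq_zero_of_lt a b (j := s - p) (by grind), mul_zero, add_zero]

theorem centralCoeff_mul_add (n : ℕ) {r : ℕ} (hr : r < p) :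
    centralCoeff a b (p * n + r) = centralCoeff a b n * centralCoeff a b r :=
  trinomialCoeff_mul_add_natCast_of_add_lt a b n (s := 0) hr

theorem centralCoeff_mul_add_self (n : ℕ) :
    centralCoeff a b (p * n + p) = centralCoeff a b (n + 1) := by
  have h := centralCoeff_mul_add a b (n + 1) (r := 0) (Nat.Prime.pos Fact.out)
  simpa [mul_add, centralCoeff_zero] using h

theorem centralCoeff_mul_add_self_add_one (n : ℕ) :
    centralCoeff a b (p * n + p + 1) = b * centralCoeff a b (n + 1) := by
  have h := centralCoeff_mul_add a b (n + 1) (r := 1) (Nat.Prime.one_lt Fact.out)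
  rwa [mul_add, mul_one, centralCoeff_one, mul_comm _ b] at h

theorem motzkinCoeff_mul_add (n : ℕ) {r : ℕ} (hr : r < p - 2) :
    motzkinCoeff a b (p * n + r) = motzkinCoeff a b r * centralCoeff a b n := by
  have hzero := centralCoeff_mul_add a b n (r := r) (by lia)
  have htwo := trinomialCoeff_mul_add_natCast_of_add_lt a b n (r := r) (s := 2) (by lia)
  rw [Nat.cast_ofNat] at htwo
  rw [motzkinCoeff, motzkinCoeff, ← centralCoeff, hzero, htwo, ← centralCoeff]
  ring

theorem centralCoeff_prime : centralCoeff a b p = b := by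
  simpa [centralCoeff_one] using centralCoeff_mul_add_self a b 0

theorem pow_mul_centralCoeff_sub_one_sub {m : ℕ} (hm : m < p) :
    (b ^ 2 - 4 * a ^ 2) ^ m * centralCoeff a b (p - 1 - m) =
      centralCoeff a b (p - 1) * centralCoeff a b m := by
  induction m using Nat.twoStepInduction with
  | zero => simp [centralCoeff_zero]
  | one =>
    have hrec := centralCoeff_recurrence a b (p - 2)
    have hcast : ((p - 2 : ℕ) : ZMod p) = -2 := by
      rw [Nat.cast_sub hm]
      simp
    rw [show p - 2 + 2 = p by lia, show p - 2 + 1 = p - 1 by lia, centralCoeff_prime,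
      hcast] at hrec
    rw [show p - 1 - 1 = p - 2 by lia, centralCoeff_one]
    linear_combination -hrec
  | more m ih₀ ih₁ =>
    have hrec := centralCoeff_recurrence a b (p - 1 - (m + 2))
    have hcast : ((p - 1 - (m + 2) : ℕ) : ZMod p) = -(m + 3) := by
      rw [Nat.sub_sub, Nat.cast_sub (by lia), CharP.cast_eq_zero]
      push_cast
      ring
    rw [show p - 1 - (m + 2) + 2 = p - 1 - m by lia,
      show p - 1 - (m + 2) + 1 = p - 1 - (m + 1) by lia, hcast] at hrec
    have hne : ((m : ZMod p) + 2) ≠ 0 := by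
      exact_mod_cast (ZMod.natCast_eq_zero_iff (m + 2) p).not.2
        (Nat.not_dvd_of_pos_of_lt (by lia) hm)
    refine mul_left_cancel₀ hne ?_
    linear_combination (-(b ^ 2 - 4 * a ^ 2) ^ (m + 1)) * hrec +
      (2 * m + 3) * b * ih₁ (by lia) - (m + 1) * (b ^ 2 - 4 * a ^ 2) * ih₀ (by lia) -
      centralCoeff a b (p - 1) * centralCoeff_recurrence a b m

theorem two_mul_sq_mul_motzkinCoeff_mul_add_sub_two (n : ℕ) :
    2 * a ^ 2 * motzkinCoeff a b (p * n + (p - 2)) =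
      b * centralCoeff a b (p - 1) * centralCoeff a b n - centralCoeff a b (n + 1) := by
  have hp := Nat.Prime.two_le (Fact.out : p.Prime)
  have hsymm := pow_mul_centralCoeff_sub_one_sub a b (m := 1) hp
  rw [show p - 1 - 1 = p - 2 by lia, centralCoeff_one] at hsymm
  rw [two_mul_sq_mul_motzkinCoeff, show p * n + (p - 2) + 1 = p * n + (p - 1) by lia,
    show p * n + (p - 2) + 2 = p * n + p by lia, centralCoeff_mul_add_self,
    centralCoeff_mul_add a b n (by lia : p - 1 < p),
    centralCoeff_mul_add a b n (by lia : p - 2 < p)]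
  linear_combination -centralCoeff a b n * hsymm

theorem two_mul_sq_mul_motzkinCoeff_mul_add_sub_one (n : ℕ) :
    2 * a ^ 2 * motzkinCoeff a b (p * n + (p - 1)) = b * centralCoeff a b (n + 1) -
      (b ^ 2 - 4 * a ^ 2) * centralCoeff a b (p - 1) * centralCoeff a b n := by
  have hp := Nat.Prime.two_le (Fact.out : p.Prime)
  rw [two_mul_sq_mul_motzkinCoeff, show p * n + (p - 1) + 1 = p * n + p by lia,
    show p * n + (p - 1) + 2 = p * n + p + 1 by lia, centralCoeff_mul_add_self,
    centralCoeff_mul_add_self_add_one, centralCoeff_mul_add a b n (by lia : p - 1 < p)]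
  ring

end Lucas

section Mean

open Filter Topology Finset

/-- The sequence `f` has mean value `d`: the averages of its first `N` terms converge to `d`. -/
def HasMean {𝕜 : Type*} [RCLike 𝕜] (f : ℕ → 𝕜) (d : 𝕜) : Prop :=
  Tendsto (fun N : ℕ => (∑ n ∈ range N, f n) / (N : 𝕜)) atTop (𝓝 d)

variable {𝕜 : Type*} [RCLike 𝕜] {f g : ℕ → 𝕜} {d e : 𝕜}

theorem HasMean.add (hf : HasMean f d) (hg : HasMean g e) :
    HasMean (fun n => f n + g n) (d + e) := by
  refine (Tendsto.add hf hg).congr fun N => ?_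
  rw [sum_add_distrib, add_div]

theorem HasMean.sub (hf : HasMean f d) (hg : HasMean g e) :
    HasMean (fun n => f n - g n) (d - e) := by
  refine (Tendsto.sub hf hg).congr fun N => ?_
  rw [sum_sub_distrib, sub_div]

theorem HasMean.const_mul (hf : HasMean f d) (c : 𝕜) : HasMean (fun n => c * f n) (c * d) := by
  refine (Tendsto.const_mul c hf).congr fun N => ?_
  rw [← mul_sum, mul_div_assoc]

theorem HasMean.sum {ι : Type*} (s : Finset ι) {f : ι → ℕ → 𝕜} {d : ι → 𝕜}
    (hf : ∀ i ∈ s, HasMean (f i) (d i)) : HasMean (fun n => ∑ i ∈ s, f i n) (∑ i ∈ s, d i) := by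
  refine (tendsto_finsetSum s hf).congr fun N => ?_
  rw [sum_comm, sum_div]

theorem hasMean_const (c : 𝕜) : HasMean (fun _ => c) c := by
  refine tendsto_const_nhds.congr' ?_
  filter_upwards [eventually_ne_atTop 0] with N hN
  simp [hN]

theorem tendsto_zero_of_le_mul_comp_add {α : Type*} {l : Filter α} {φ : α → α}
    (hφ : Tendsto φ l l) {x y : α → ℝ} {A θ : ℝ} (hθ0 : 0 ≤ θ) (hθ1 : θ < 1)
    (hx0 : ∀ i, 0 ≤ x i) (hxA : ∀ i, x i ≤ A) (hy : Tendsto y l (𝓝 0))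
    (hx : ∀ i, x i ≤ θ * x (φ i) + y i) : Tendsto x l (𝓝 0) := by
  have iterate (k : ℕ) : ∀ δ > 0, ∀ᶠ i in l, x i ≤ θ ^ k * A + δ := by
    induction k with
    | zero => exact fun δ hδ => .of_forall fun i => by linarith [hxA i]
    | succ k ih =>
      intro δ hδ
      filter_upwards [hφ.eventually (ih (δ / 2) (half_pos hδ)),
        hy.eventually_lt_const (half_pos hδ)] with i hφi hyi
      calc x i ≤ θ * x (φ i) + y i := hx i
        _ ≤ θ * (θ ^ k * A + δ / 2) + δ / 2 := by gcongr
        _ ≤ θ ^ (k + 1) * A + δ := by rw [pow_succ']; nlinarith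
  refine tendsto_order.2 ⟨fun ε hε => .of_forall fun i => hε.trans_le (hx0 i), fun ε hε => ?_⟩
  have hpow : Tendsto (fun k => θ ^ k * A) atTop (𝓝 0) := by
    simpa using (tendsto_pow_atTop_nhds_zero_of_lt_one hθ0 hθ1).mul_const A
  obtain ⟨k, hk⟩ := (hpow.eventually_lt_const (half_pos hε)).exists
  filter_upwards [iterate k (ε / 4) (by positivity)] with i hi
  linarith

theorem sum_range_mul_eq_sum_sum {M : Type*} [AddCommMonoid M] (p N : ℕ) (f : ℕ → M) :
    ∑ n ∈ range (p * N), f n = ∑ n ∈ range N, ∑ r ∈ range p, f (p * n + r) := by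
  induction N with
  | zero => simp
  | succ N ih => rw [mul_add, mul_one, sum_range_add, ih, sum_range_succ]

theorem norm_sum_range_le_norm_sum_range_mul_div_add {E : Type*} [SeminormedAddCommGroup E]
    {f : ℕ → E} {B : ℝ} (hB : ∀ n, ‖f n‖ ≤ B) {p : ℕ} (hp : 0 < p) (N : ℕ) :
    ‖∑ n ∈ range N, f n‖ ≤ ‖∑ n ∈ range (p * (N / p)), f n‖ + p * B := by
  have hB0 : 0 ≤ B := (norm_nonneg _).trans (hB 0)
  have hmod : ((N % p : ℕ) : ℝ) ≤ p := by exact_mod_cast (Nat.mod_lt N hp).le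
  conv_lhs => rw [← Nat.div_add_mod N p, sum_range_add]
  refine (norm_add_le _ _).trans (add_le_add le_rfl ?_)
  calc ‖∑ n ∈ range (N % p), f (p * (N / p) + n)‖ ≤ (N % p : ℕ) * B := by
        simpa using norm_sum_le_of_le (range (N % p)) fun n _ => hB (p * (N / p) + n)
    _ ≤ p * B := by gcongr

theorem norm_sum_range_div_div_le (f : ℕ → 𝕜) (p N : ℕ) :
    ‖∑ n ∈ range (N / p), f n‖ / N ≤ ‖(∑ n ∈ range (N / p), f n) / ((N / p : ℕ) : 𝕜)‖ / p := by
  rcases (N / p).eq_zero_or_pos with hK | hK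
  · simp [hK]
  have hp : p ≠ 0 := by
    rintro rfl
    simp at hK
  rw [norm_div, RCLike.norm_natCast, div_div]
  gcongr
  exact_mod_cast Nat.div_mul_le_self N p

theorem HasMean.zero_of_norm_sum_range_mul_le {𝕂 : Type*} [RCLike 𝕂] {B : ℝ}
    (hB : ∀ n, ‖f n‖ ≤ B) {h : ℕ → 𝕂} (hh : HasMean h 0) {p : ℕ} {c : ℝ} (hc0 : 0 ≤ c)
    (hcp : c < p) (hf : ∀ N, ‖∑ n ∈ range (p * N), f n‖ ≤
      c * ‖∑ n ∈ range N, f n‖ + ‖∑ n ∈ range N, h n‖) :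
    HasMean f 0 := by
  have hp : 0 < p := by exact_mod_cast hc0.trans_lt hcp
  have hp' : (0 : ℝ) < p := by exact_mod_cast hp
  have hdiv : Tendsto (fun N : ℕ => N / p) atTop atTop := Nat.tendsto_div_const_atTop hp.ne'
  have hrest : Tendsto (fun N : ℕ => ‖(∑ n ∈ range (N / p), h n) / ((N / p : ℕ) : 𝕂)‖ / p +
      p * B / N) atTop (𝓝 0) := by
    simpa using ((hh.norm.comp hdiv).div_const (p : ℝ)).add
      (tendsto_const_div_atTop_nhds_zero_nat (p * B))
  rw [HasMean, tendsto_zero_iff_norm_tendsto_zero]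
  refine tendsto_zero_of_le_mul_comp_add (A := B) (θ := c / p) hdiv (by positivity)
    ((div_lt_one hp').2 hcp) (fun N => norm_nonneg _) (fun N => ?_) hrest fun N => ?_
  · rw [norm_div, RCLike.norm_natCast]
    refine div_le_of_le_mul₀ N.cast_nonneg ((norm_nonneg _).trans (hB 0)) ?_
    simpa [mul_comm] using norm_sum_le_of_le (range N) fun n _ => hB n
  calc ‖(∑ n ∈ range N, f n) / (N : 𝕜)‖ = ‖∑ n ∈ range N, f n‖ / N := by
        rw [norm_div, RCLike.norm_natCast]
    _ ≤ (c * ‖∑ n ∈ range (N / p), f n‖ + ‖∑ n ∈ range (N / p), h n‖ + p * B) / N := by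
        gcongr
        exact (norm_sum_range_le_norm_sum_range_mul_div_add hB hp N).trans (by grw [hf])
    _ = c * (‖∑ n ∈ range (N / p), f n‖ / N) + ‖∑ n ∈ range (N / p), h n‖ / N + p * B / N := by
        ring
    _ ≤ c * (‖(∑ n ∈ range (N / p), f n) / ((N / p : ℕ) : 𝕜)‖ / p) +
          ‖(∑ n ∈ range (N / p), h n) / ((N / p : ℕ) : 𝕂)‖ / p + p * B / N := by
        linarith [mul_le_mul_of_nonneg_left (norm_sum_range_div_div_le f p N) hc0,
          norm_sum_range_div_div_le h p N]
    _ = _ := by ring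

theorem HasMean.of_sum_block {B : ℝ} (hB : ∀ n, ‖f n‖ ≤ B) {h : ℕ → 𝕜} (hh : HasMean h d)
    {p : ℕ} {C : 𝕜} (hC : ‖C‖ < p)
    (hf : ∀ n, ∑ r ∈ range p, f (p * n + r) = C * f n + h n) :
    HasMean f (d / (p - C)) := by
  have hpC : (p : 𝕜) - C ≠ 0 := by
    intro h0
    rw [← sub_eq_zero.1 h0, RCLike.norm_natCast] at hC
    exact hC.false
  obtain ⟨m, hm⟩ : ∃ m, (p - C) * m = d := ⟨_, mul_div_cancel₀ d hpC⟩
  rw [← hm, mul_div_cancel_left₀ m hpC]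
  have hcentred : HasMean (fun n => f n - m) 0 := by
    refine HasMean.zero_of_norm_sum_range_mul_le (h := fun n => h n - d) (c := ‖C‖)
      (B := B + ‖m‖) (fun n => (norm_sub_le _ _).trans (by grw [hB]))
      (by simpa using hh.sub (hasMean_const d)) (norm_nonneg C) hC fun N => ?_
    rw [← norm_mul, mul_sum, sum_range_mul_eq_sum_sum]
    refine le_of_eq_of_le (congrArg _ ?_) (norm_add_le _ _)
    rw [← sum_add_distrib]
    refine sum_congr rfl fun n _ => ?_
    rw [sum_sub_distrib, hf, sum_const, card_range, nsmul_eq_mul]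
    linear_combination -hm
  simpa using hcentred.add (hasMean_const m)

theorem HasMean.of_sum_block_swap {p : ℕ} (hp : 1 < p) {B : ℝ} (hfB : ∀ n, ‖f n‖ ≤ B)
    (hgB : ∀ n, ‖g n‖ ≤ B) {u v : ℕ → 𝕜} (hu : HasMean u d) (hv : HasMean v e)
    (hf : ∀ n, ∑ r ∈ range p, f (p * n + r) = g n + u n)
    (hg : ∀ n, ∑ r ∈ range p, g (p * n + r) = f n + v n) :
    HasMean f ((p * d + e) / ((p - 1) * (p + 1))) := by
  have hp' : (1 : ℝ) < p := by exact_mod_cast hp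
  -- The sum and the difference satisfy separate recurrences, with multipliers `1` and `-1`.
  have hadd : HasMean (fun n => f n + g n) ((d + e) / (p - 1)) :=
    .of_sum_block (B := B + B) (fun n => (norm_add_le _ _).trans (by grw [hfB, hgB]))
      (hu.add hv) (by simpa using hp') fun n => by rw [sum_add_distrib, hf, hg]; ring
  have hsub : HasMean (fun n => f n - g n) ((d - e) / (p - -1)) :=
    .of_sum_block (B := B + B) (fun n => (norm_sub_le _ _).trans (by grw [hfB, hgB]))
      (hu.sub hv) (by simpa using hp') fun n => by rw [sum_sub_distrib, hf, hg]; ring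
  have hp1 : (p : 𝕜) - 1 ≠ 0 := sub_ne_zero.2 (by exact_mod_cast hp.ne')
  have hp2 : (p : 𝕜) + 1 ≠ 0 := by exact_mod_cast p.succ_ne_zero
  convert (hadd.add hsub).const_mul (1 / 2) using 1
  · ext n
    ring
  · rw [sub_neg_eq_add]
    field_simp
    ring

end Mean

section NullSets

open Filter Topology Finset

variable {S Z : Set ℕ} {d : ℝ}

theorem indicator_one_le_one {α : Type*} (T : Set α) (x : α) :
    T.indicator (1 : α → ℝ) x ≤ 1 :=
  Set.indicator_apply_le' (fun _ => le_rfl) fun _ => zero_le_one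

theorem indicator_one_nonneg {α : Type*} (T : Set α) (x : α) : 0 ≤ T.indicator (1 : α → ℝ) x :=
  Set.indicator_nonneg (fun _ _ => zero_le_one) x

theorem hasAsymptoticDensity_iff_hasMean_indicator (𝕜 : Type*) [RCLike 𝕜] :
    HasAsymptoticDensity S d ↔ HasMean (S.indicator 1 : ℕ → 𝕜) d := by
  classical
  rw [HasAsymptoticDensity, HasMean, ← tendsto_ofReal_iff' (𝕜 := 𝕜)]
  refine tendsto_congr fun N => ?_
  have hfilter : S ∩ {n | n < N} = ((range N).filter (· ∈ S) : Finset ℕ) := by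
    ext n
    simp [and_comm]
  simp [hfilter, -coe_filter, Set.ncard_coe_finset, Set.indicator_apply]

theorem HasAsymptoticDensity.compl (hS : HasAsymptoticDensity S d) :
    HasAsymptoticDensity Sᶜ (1 - d) := by
  rw [hasAsymptoticDensity_iff_hasMean_indicator ℝ] at hS ⊢
  rw [Set.indicator_compl, RCLike.ofReal_sub, RCLike.ofReal_one]
  exact (hasMean_const (1 : ℝ)).sub hS

theorem sum_range_indicator_mul_add_le {p : ℕ}
    (hS : ∀ n ∉ Z, ∀ r < p, p * n + r ∈ S → n ∈ S)
    {r₀ : ℕ} (hr₀ : r₀ < p) (hleave : ∀ n ∉ Z, p * n + r₀ ∉ S) (n : ℕ) :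
    ∑ r ∈ range p, S.indicator (1 : ℕ → ℝ) (p * n + r) ≤
      (p - 1) * S.indicator 1 n + p * Z.indicator 1 n := by
  have hp : (1 : ℝ) ≤ p := by exact_mod_cast hr₀.pos
  by_cases hnZ : n ∈ Z
  · simp only [hnZ, Set.indicator_of_mem, Pi.one_apply, mul_one]
    have hsum := sum_le_card_nsmul (range p) _ 1 fun r _ => indicator_one_le_one S (p * n + r)
    rw [card_range, nsmul_one] at hsum
    nlinarith [indicator_one_nonneg S n, hp]
  have hdigit (r) (hr : r ∈ (range p).erase r₀) :
      S.indicator (1 : ℕ → ℝ) (p * n + r) ≤ S.indicator 1 n := by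
    by_cases hr' : p * n + r ∈ S
    · rw [Set.indicator_of_mem (hS n hnZ r (mem_range.1 (mem_of_mem_erase hr)) hr')]
      exact indicator_one_le_one S _
    · rw [Set.indicator_of_notMem hr']
      exact indicator_one_nonneg S n
  have hsum := sum_le_card_nsmul _ _ _ hdigit
  rw [card_erase_of_mem (mem_range.2 hr₀), card_range, nsmul_eq_mul,
    Nat.cast_pred hr₀.pos] at hsum
  rwa [← add_sum_erase _ _ (mem_range.2 hr₀), Set.indicator_of_notMem (hleave n hnZ), zero_add,
    Set.indicator_of_notMem hnZ, mul_zero, add_zero]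

theorem HasAsymptoticDensity.zero_of_digits {p : ℕ} (hZ : HasAsymptoticDensity Z 0)
    (hS : ∀ n ∉ Z, ∀ r < p, p * n + r ∈ S → n ∈ S)
    {r₀ : ℕ} (hr₀ : r₀ < p) (hleave : ∀ n ∉ Z, p * n + r₀ ∉ S) :
    HasAsymptoticDensity S 0 := by
  rw [hasAsymptoticDensity_iff_hasMean_indicator ℝ] at hZ ⊢
  have hp : (1 : ℝ) ≤ p := by exact_mod_cast hr₀.pos
  have norm_sum (T : Set ℕ) (N : ℕ) : ‖∑ n ∈ range N, T.indicator (1 : ℕ → ℝ) n‖ =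
      ∑ n ∈ range N, T.indicator (1 : ℕ → ℝ) n :=
    Real.norm_of_nonneg (sum_nonneg fun n _ => indicator_one_nonneg T n)
  refine HasMean.zero_of_norm_sum_range_mul_le (B := 1) (c := p - 1) (p := p)
    (h := fun n => (p * Z.indicator 1 n : ℝ)) (fun n => ?_) (by simpa using hZ.const_mul (p : ℝ))
    (by simpa using hp) (by simp) fun N => ?_
  · rw [Real.norm_of_nonneg (indicator_one_nonneg S n)]
    exact indicator_one_le_one S n
  · rw [norm_sum, norm_sum, ← mul_sum, norm_mul, norm_sum, Real.norm_natCast,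
      sum_range_mul_eq_sum_sum, mul_sum, mul_sum, ← sum_add_distrib]
    exact sum_le_sum fun n _ => sum_range_indicator_mul_add_le hS hr₀ hleave n

end NullSets

section Characters

open Finset

theorem norm_sum_lt_card_of_ne {E ι : Type*} [NormedAddCommGroup E] [NormedSpace ℝ E]
    [StrictConvexSpace ℝ E] {s : Finset ι} {f : ι → E} (hf : ∀ i ∈ s, ‖f i‖ ≤ 1) {i j : ι}
    (hi : i ∈ s) (hj : j ∈ s) (hij : f i ≠ f j) : ‖∑ k ∈ s, f k‖ < #s := by
  have hs : (0 : ℝ) < #s := by exact_mod_cast card_pos.2 ⟨i, hi⟩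
  have h := norm_sum_lt_of_strictConvexSpace (w := fun _ => (#s : ℝ)⁻¹) (fun _ _ => by positivity)
    (by simp [hs.ne']) hi hj hij (by positivity) (by positivity) hf
  rwa [← smul_sum, norm_smul, norm_inv, Real.norm_natCast, inv_mul_lt_one₀ hs] at h

theorem hasMean_char_zero_of_mul_digits {p q : ℕ} (χ : DirichletCharacter ℂ q) {x : ℕ → ZMod q}
    (hx₀ : x 0 = 1) (hx : ∀ n, ∀ r < p, x (p * n + r) = x n * x r) {m : ℕ} (hm : m < p)
    (hχ : χ (x m) ≠ 1) : HasMean (fun n => χ (x n)) 0 := by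
  have hC : ‖∑ r ∈ range p, χ (x r)‖ < p := by
    simpa using norm_sum_lt_card_of_ne (fun r _ => χ.norm_le_one (x r)) (mem_range.2 hm)
      (mem_range.2 (hm.pos)) (by simpa [hx₀] using hχ)
  refine zero_div ((p : ℂ) - _) ▸ HasMean.of_sum_block (fun n => χ.norm_le_one _)
    (hasMean_const 0) hC fun n => ?_
  rw [add_zero, sum_mul]
  refine sum_congr rfl fun r hr => ?_
  rw [hx n r (mem_range.1 hr), map_mul, mul_comm]

theorem mulChar_eq_one_of_closure_eq_top {R M : Type*} [CommMonoid R] [CommMonoidWithZero M]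
    {χ : MulChar R M} {s : Set Rˣ} (hs : Subgroup.closure s = ⊤) (hχ : ∀ u ∈ s, χ u = 1) :
    χ = 1 := by
  refine MulChar.equivToUnitHom.injective (MonoidHom.eq_of_eqOn_dense hs fun u hu => ?_)
  ext
  rw [MulChar.coe_equivToUnitHom, MulChar.coe_equivToUnitHom, hχ u hu, MulChar.one_apply_coe]

theorem mulChar_one_apply_eq_ite {F M : Type*} [Field F] [DecidableEq F] [CommMonoidWithZero M]
    (x : F) : (1 : MulChar F M) x = if x = 0 then 0 else 1 := by
  split_ifs with h
  · rw [h, MulChar.map_zero]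
  · exact MulChar.one_apply (isUnit_iff_ne_zero.2 h)

theorem hasAsymptoticDensity_eq_zero_iff {F : Type*} [Field F] (x : ℕ → F) (d : ℝ) :
    HasAsymptoticDensity {n | x n = 0} d ↔
      HasMean (fun n => (1 : MulChar F ℂ) (x n)) ((1 - d : ℝ) : ℂ) := by
  classical
  have hone : (fun n => (1 : MulChar F ℂ) (x n)) = {n | x n = 0}ᶜ.indicator 1 := by
    ext n
    simp [mulChar_one_apply_eq_ite, Set.indicator_apply]
  rw [hone]
  refine Iff.trans ⟨fun h => h.compl, fun h => ?_⟩ (hasAsymptoticDensity_iff_hasMean_indicator ℂ)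
  rw [← compl_compl {n | x n = 0}, ← sub_sub_cancel 1 d]
  exact h.compl

theorem hasAsymptoticDensity_of_hasMean_char {q : ℕ} [NeZero q] {x : ℕ → ZMod q} {e : ℝ}
    (hone : HasMean (fun n => (1 : DirichletCharacter ℂ q) (x n)) e)
    (hχ : ∀ χ : DirichletCharacter ℂ q, χ ≠ 1 → HasMean (fun n => χ (x n)) 0)
    {k : ZMod q} (hk : IsUnit k) : HasAsymptoticDensity {n | x n = k} (e / q.totient) := by
  classical
  have hmean (χ : DirichletCharacter ℂ q) :
      HasMean (fun n => χ k⁻¹ * χ (x n)) (if χ = 1 then (e : ℂ) else 0) := by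
    split_ifs with h
    · have hk' : IsUnit k⁻¹ := .of_mul_eq_one k (ZMod.inv_mul_of_unit k hk)
      simpa [h, MulChar.one_apply hk'] using hone
    · simpa using (hχ χ h).const_mul (χ k⁻¹)
  have hsum := (HasMean.sum univ fun χ _ => hmean χ).const_mul (q.totient : ℂ)⁻¹
  have htotient : (q.totient : ℂ) ≠ 0 := by
    exact_mod_cast (Nat.totient_pos.2 (NeZero.pos q)).ne'
  rw [hasAsymptoticDensity_iff_hasMean_indicator ℂ]
  convert hsum using 1
  · ext n
    rw [DirichletCharacter.sum_char_inv_mul_char_eq ℂ hk, Set.indicator_apply]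
    simp only [Set.mem_ofPred_eq, eq_comm (a := k)]
    split_ifs <;> simp [htotient]
  · rw [sum_ite_eq' univ, if_pos (mem_univ _)]
    rw [div_eq_inv_mul]
    push_cast
    rfl

theorem sum_one_char_eq_sub_ncard {F : Type*} [Field F] (g : ℕ → F) (m : ℕ) :
    ∑ r ∈ range m, (1 : MulChar F ℂ) (g r) = m - {r | r < m ∧ g r = 0}.ncard := by
  classical
  have hset : {r | r < m ∧ g r = 0} = ((range m).filter (g · = 0) : Finset ℕ) := by
    ext r
    simp
  have hone (r : ℕ) : (1 : MulChar F ℂ) (g r) = 1 - if g r = 0 then 1 else 0 := by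
    rw [mulChar_one_apply_eq_ite]
    split_ifs <;> simp
  simp only [hset, Set.ncard_coe_finset, hone, sum_sub_distrib, sum_boole, sum_const, card_range,
    nsmul_one]

end Characters

section VanishingCentralCoeff

variable {p : ℕ} [Fact p.Prime] {a b : ZMod p}

theorem trinomialCoeff_mul_add_two_eq_zero {n : ℕ} (h₀ : centralCoeff a b n = 0)
    (h₁ : trinomialCoeff a b n 1 = 0) {r : ℕ} (hr : r < p) :
    trinomialCoeff a b (p * n + r) 2 = 0 := by
  rcases (Nat.Prime.two_le (Fact.out : p.Prime)).eq_or_lt with rfl | hp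
  · have h := trinomialCoeff_mul_add 2 a b n hr 1 (s := 0) two_pos
    rw [ZMod.pow_card, ZMod.pow_card, h₁,
      trinomialCoeff_eq_zero_of_lt a b (j := (0 : ℕ) - (2 : ℕ)) (by grind)] at h
    simpa using h
  · simpa [h₀, h₁] using trinomialCoeff_mul_add_natCast a b n hr hp

theorem hasAsymptoticDensity_centralCoeff_ne_zero {m : ℕ} (hm : m < p)
    (hm0 : centralCoeff a b m = 0) : HasAsymptoticDensity {n | centralCoeff a b n ≠ 0} 0 := by
  have hempty : HasAsymptoticDensity ∅ 0 := by simp [HasAsymptoticDensity]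
  refine hempty.zero_of_digits (fun n _ r hr hne => ?_) hm fun n _ hne => ?_
  · refine left_ne_zero_of_mul (b := centralCoeff a b r) ?_
    rwa [← centralCoeff_mul_add a b n hr]
  · exact hne (by rw [centralCoeff_mul_add a b n hm, hm0, mul_zero])

theorem hasAsymptoticDensity_not_centralCoeff_eq_zero_and_trinomialCoeff_one_eq_zero
    (hcentral : HasAsymptoticDensity {n | centralCoeff a b n ≠ 0} 0) :
    HasAsymptoticDensity {n | ¬(centralCoeff a b n = 0 ∧ trinomialCoeff a b n 1 = 0)} 0 := by
  have hp : 1 < p := Nat.Prime.one_lt Fact.out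
  have hdigit {n r : ℕ} (hr : r < p) (hn : centralCoeff a b n = 0) :
      centralCoeff a b (p * n + r) = 0 ∧ trinomialCoeff a b (p * n + r) 1 =
        trinomialCoeff a b n 1 * trinomialCoeff a b r (1 - p) :=
    ⟨by rw [centralCoeff_mul_add a b n hr, hn, zero_mul],
      by simpa [hn] using trinomialCoeff_mul_add_natCast a b n hr hp⟩
  refine hcentral.zero_of_digits (fun n _ r hr hne h => ?_) hp.pos fun n hn hne => ?_
  · obtain ⟨hzero, hone⟩ := hdigit hr h.1
    exact hne ⟨hzero, by rw [hone, h.2, zero_mul]⟩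
  · obtain ⟨hzero, hone⟩ := hdigit hp.pos (not_not.1 hn)
    exact hne ⟨hzero, by rw [hone, trinomialCoeff_zero, if_neg (by lia), mul_zero]⟩

-- Reading `n` from its leading digit, a digit `m` makes the coefficient of `T ^ 0` vanish for good,
-- a later digit `0` that of `T ^ 1`, and one more digit of any value the Motzkin number.
theorem hasAsymptoticDensity_motzkinCoeff_ne_zero {m : ℕ} (hm : m < p)
    (hm0 : centralCoeff a b m = 0) : HasAsymptoticDensity {n | motzkinCoeff a b n ≠ 0} 0 := by
  have hpair := hasAsymptoticDensity_not_centralCoeff_eq_zero_and_trinomialCoeff_one_eq_zero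
    (hasAsymptoticDensity_centralCoeff_ne_zero hm hm0)
  have hmotzkin {n r : ℕ} (hr : r < p) (hn : centralCoeff a b n = 0 ∧ trinomialCoeff a b n 1 = 0) :
      motzkinCoeff a b (p * n + r) = 0 := by
    rw [motzkinCoeff, ← centralCoeff, centralCoeff_mul_add a b n hr, hn.1, zero_mul,
      trinomialCoeff_mul_add_two_eq_zero hn.1 hn.2 hr, sub_zero]
  exact hpair.zero_of_digits (fun n hn r hr hne => absurd (hmotzkin hr (not_not.1 hn)) hne) hm.pos
    fun n hn hne => hne (hmotzkin hm.pos (not_not.1 hn))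

end VanishingCentralCoeff

section NonvanishingCentralCoeff

open Finset

theorem sum_range_eq_sum_range_sub_one_add {M : Type*} [AddCommMonoid M] {n : ℕ} (hn : 0 < n)
    (f : ℕ → M) : ∑ r ∈ range n, f r = ∑ r ∈ range (n - 1), f r + f (n - 1) := by
  rw [← sum_range_succ, Nat.sub_add_cancel hn]

theorem two_mul_sq_ne_zero {p : ℕ} [Fact p.Prime] (hp2 : 2 < p) {a : ZMod p} (ha : a ≠ 0) :
    2 * a ^ 2 ≠ 0 := by
  have : Fact (2 < p) := ⟨hp2⟩
  exact mul_ne_zero (Ring.two_ne_zero (by rw [ZMod.ringChar_zmod_n]; lia)) (pow_ne_zero _ ha)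

variable {p : ℕ} [Fact p.Prime] {a b : ZMod p}

theorem centralCoeff_ne_zero (hT : ∀ n < p, centralCoeff a b n ≠ 0) (n : ℕ) :
    centralCoeff a b n ≠ 0 := by
  have hp : 1 < p := Nat.Prime.one_lt Fact.out
  induction n using Nat.strong_induction_on with
  | _ n ih =>
  by_cases hn : n < p
  · exact hT n hn
  · have hmod := Nat.mod_lt n hp.pos
    rw [← Nat.div_add_mod n p, centralCoeff_mul_add a b _ hmod]
    exact mul_ne_zero (ih _ (Nat.div_lt_self (by lia) hp)) (hT _ hmod)

theorem sq_sub_four_mul_sq_ne_zero (hT : ∀ n < p, centralCoeff a b n ≠ 0) :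
    b ^ 2 - 4 * a ^ 2 ≠ 0 := by
  have hp : 1 < p := Nat.Prime.one_lt Fact.out
  have hne := mul_ne_zero (hT (p - 1) (by lia)) (hT 1 hp)
  rw [← pow_mul_centralCoeff_sub_one_sub a b hp, pow_one] at hne
  exact left_ne_zero_of_mul hne

theorem centralCoeff_sub_one_mul_self (hT : ∀ n < p, centralCoeff a b n ≠ 0) :
    centralCoeff a b (p - 1) * centralCoeff a b (p - 1) = 1 := by
  have hp : 1 < p := Nat.Prime.one_lt Fact.out
  rw [← pow_mul_centralCoeff_sub_one_sub a b (by lia : p - 1 < p), Nat.sub_self,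
    ZMod.pow_card_sub_one_eq_one (sq_sub_four_mul_sq_ne_zero hT), centralCoeff_zero, one_mul]

variable (a b) in
/-- The sum of `χ (x T_m + y T_{m+1})` over the `p - 1` pairs of consecutive central trinomial
coefficients with indices below `p`. -/
noncomputable def linearFormCharSum (χ : DirichletCharacter ℂ p) (x y : ZMod p) : ℂ :=
  ∑ m ∈ range (p - 1), χ (x * centralCoeff a b m + y * centralCoeff a b (m + 1))

variable (a b) in
/-- The mean of `χ (x T_{p-1} T_n + y T_{n+1})` divided by that of `χ (T_n)`, where `T` denotes the
central trinomial coefficients. -/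
noncomputable def linearFormFactor (χ : DirichletCharacter ℂ p) (x y : ZMod p) : ℂ :=
  (p * linearFormCharSum a b χ (x * centralCoeff a b (p - 1)) y + linearFormCharSum a b χ x y) /
    ((p - 1) * (p + 1))

variable (a b) in
/-- The mean of `χ` along the Motzkin numbers divided by that along the central trinomial
coefficients. The last two summands come from the last two digits in base `p`. -/
noncomputable def motzkinFactor (χ : DirichletCharacter ℂ p) : ℂ :=
  (∑ r ∈ range (p - 2), χ (motzkinCoeff a b r) + χ (2 * a ^ 2)⁻¹ * linearFormFactor a b χ b (-1) +
    χ (2 * a ^ 2)⁻¹ * linearFormFactor a b χ (-(b ^ 2 - 4 * a ^ 2)) b) / p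

variable (a b) in
theorem sum_char_linearForm_mul_add (χ : DirichletCharacter ℂ p) (x y : ZMod p) (n : ℕ) :
    ∑ r ∈ range p, χ (x * centralCoeff a b (p * n + r) + y * centralCoeff a b (p * n + r + 1)) =
      χ (x * centralCoeff a b (p - 1) * centralCoeff a b n + y * centralCoeff a b (n + 1)) +
        linearFormCharSum a b χ x y * χ (centralCoeff a b n) := by
  have hp : 1 < p := Nat.Prime.one_lt Fact.out
  rw [sum_range_eq_sum_range_sub_one_add hp.pos, add_comm, linearFormCharSum, sum_mul]
  congr 1
  · rw [centralCoeff_mul_add a b n (by lia), show p * n + (p - 1) + 1 = p * n + p by lia,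
      centralCoeff_mul_add_self]
    ring_nf
  · refine sum_congr rfl fun r hr => ?_
    rw [mem_range] at hr
    rw [← map_mul, add_assoc, centralCoeff_mul_add a b n (by lia),
      centralCoeff_mul_add a b n (by lia)]
    ring_nf

theorem hasMean_char_linearForm (hT : ∀ n < p, centralCoeff a b n ≠ 0)
    (χ : DirichletCharacter ℂ p) {t : ℂ} (ht : HasMean (fun n => χ (centralCoeff a b n)) t)
    (x y : ZMod p) :
    HasMean (fun n => χ (x * centralCoeff a b (p - 1) * centralCoeff a b n +
      y * centralCoeff a b (n + 1))) (linearFormFactor a b χ x y * t) := by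
  have hp : 1 < p := Nat.Prime.one_lt Fact.out
  have hswap (n : ℕ) := sum_char_linearForm_mul_add a b χ (x * centralCoeff a b (p - 1)) y n
  simp only [mul_assoc, centralCoeff_sub_one_mul_self hT, mul_one] at hswap ⊢
  have h := HasMean.of_sum_block_swap hp
    (f := fun n => χ (x * (centralCoeff a b (p - 1) * centralCoeff a b n) +
      y * centralCoeff a b (n + 1)))
    (g := fun n => χ (x * centralCoeff a b n + y * centralCoeff a b (n + 1)))
    (fun n => χ.norm_le_one _) (fun n => χ.norm_le_one _)
    (ht.const_mul _) (ht.const_mul _) hswap fun n => by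
      simpa only [mul_assoc] using sum_char_linearForm_mul_add a b χ x y n
  convert h using 1
  rw [linearFormFactor]
  ring

theorem hasMean_char_motzkinCoeff (hT : ∀ n < p, centralCoeff a b n ≠ 0) (hp2 : 2 < p)
    (ha : a ≠ 0) (χ : DirichletCharacter ℂ p) {t : ℂ}
    (ht : HasMean (fun n => χ (centralCoeff a b n)) t) :
    HasMean (fun n => χ (motzkinCoeff a b n)) (motzkinFactor a b χ * t) := by
  have ha' := two_mul_sq_ne_zero hp2 ha
  have hpred (n : ℕ) : χ (motzkinCoeff a b (p * n + (p - 2))) = χ (2 * a ^ 2)⁻¹ *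
      χ (b * centralCoeff a b (p - 1) * centralCoeff a b n + -1 * centralCoeff a b (n + 1)) := by
    rw [← map_mul, neg_one_mul, ← sub_eq_add_neg,
      ← two_mul_sq_mul_motzkinCoeff_mul_add_sub_two, inv_mul_cancel_left₀ ha']
  have hlast (n : ℕ) : χ (motzkinCoeff a b (p * n + (p - 1))) = χ (2 * a ^ 2)⁻¹ *
      χ (-(b ^ 2 - 4 * a ^ 2) * centralCoeff a b (p - 1) * centralCoeff a b n +
        b * centralCoeff a b (n + 1)) := by
    rw [← map_mul, neg_mul, neg_mul, neg_add_eq_sub,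
      ← two_mul_sq_mul_motzkinCoeff_mul_add_sub_one, inv_mul_cancel_left₀ ha']
  have h := HasMean.of_sum_block (p := p) (C := 0) (fun n => χ.norm_le_one _)
    (((ht.const_mul (∑ r ∈ range (p - 2), χ (motzkinCoeff a b r))).add
      ((hasMean_char_linearForm hT χ ht b (-1)).const_mul (χ (2 * a ^ 2)⁻¹))).add
      ((hasMean_char_linearForm hT χ ht (-(b ^ 2 - 4 * a ^ 2)) b).const_mul (χ (2 * a ^ 2)⁻¹)))
    (by simpa using hp2.pos) (f := fun n => χ (motzkinCoeff a b n)) fun n => ?_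
  · convert h using 1
    rw [motzkinFactor, sub_zero]
    ring
  · rw [sum_range_eq_sum_range_sub_one_add (by lia), sum_range_eq_sum_range_sub_one_add (by lia),
      Nat.sub_sub, hpred, hlast, zero_mul, zero_add, sum_mul]
    congr 2
    refine sum_congr rfl fun r hr => ?_
    rw [motzkinCoeff_mul_add a b n (mem_range.1 hr), map_mul]

theorem linearForm_reflect (hT : ∀ n < p, centralCoeff a b n ≠ 0) {η : ZMod p} (hη : η * η = 1)
    {m : ℕ} (hm : m + 1 < p) :
    b * η * centralCoeff a b m + -1 * centralCoeff a b (m + 1) =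
      (b ^ 2 - 4 * a ^ 2) ^ m * η * centralCoeff a b (p - 1) *
        (-(b ^ 2 - 4 * a ^ 2) * η * centralCoeff a b (p - 1 - (m + 1)) +
          b * centralCoeff a b (p - 1 - m)) := by
  have hm' := pow_mul_centralCoeff_sub_one_sub a b (by lia : m < p)
  have hsucc := pow_mul_centralCoeff_sub_one_sub a b hm
  have hsq := centralCoeff_sub_one_mul_self hT
  linear_combination (-η * b * centralCoeff a b (p - 1)) * hm' +
    (η * η * centralCoeff a b (p - 1)) * hsucc - (η * b * centralCoeff a b m) * hsq +
    centralCoeff a b (m + 1) * hsq +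
    centralCoeff a b (m + 1) * centralCoeff a b (p - 1) * centralCoeff a b (p - 1) * hη

theorem linearFormCharSum_one_reflect (hT : ∀ n < p, centralCoeff a b n ≠ 0) {η : ZMod p}
    (hη : η * η = 1) :
    linearFormCharSum a b 1 (-(b ^ 2 - 4 * a ^ 2) * η) b =
      linearFormCharSum a b 1 (b * η) (-1) := by
  rw [linearFormCharSum, ← sum_range_reflect]
  refine sum_congr rfl fun m hm => ?_
  rw [mem_range] at hm
  have hunit : IsUnit ((b ^ 2 - 4 * a ^ 2) ^ m * η * centralCoeff a b (p - 1)) :=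
    isUnit_iff_ne_zero.2 <| mul_ne_zero (mul_ne_zero
      (pow_ne_zero _ (sq_sub_four_mul_sq_ne_zero hT)) (left_ne_zero_of_mul_eq_one hη))
      (hT _ (by lia))
  rw [linearForm_reflect hT hη (by lia : m + 1 < p), map_mul, MulChar.one_apply hunit, one_mul,
    show p - 1 - 1 - m + 1 = p - 1 - m by lia, show p - 1 - 1 - m = p - 1 - (m + 1) by lia]

theorem linearFormFactor_one_reflect (hT : ∀ n < p, centralCoeff a b n ≠ 0) :
    linearFormFactor a b 1 (-(b ^ 2 - 4 * a ^ 2)) b = linearFormFactor a b 1 b (-1) := by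
  have h := linearFormCharSum_one_reflect hT (one_mul 1)
  rw [mul_one, mul_one] at h
  rw [linearFormFactor, linearFormFactor, h,
    linearFormCharSum_one_reflect hT (centralCoeff_sub_one_mul_self hT)]

theorem linearFormCharSum_one_eq_sub_ncard {η : ZMod p} (hη : η * η = 1) :
    linearFormCharSum a b 1 (b * η) (-1) = (p - 1 : ℕ) -
      {m | m < p - 1 ∧ b * centralCoeff a b m = η * centralCoeff a b (m + 1)}.ncard := by
  rw [linearFormCharSum, sum_one_char_eq_sub_ncard]
  congr! 6 with m
  have hη0 : η ≠ 0 := left_ne_zero_of_mul_eq_one hη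
  rw [neg_one_mul, ← sub_eq_add_neg, sub_eq_zero, ← mul_right_inj' hη0,
    show η * (b * η * centralCoeff a b m) = η * η * (b * centralCoeff a b m) by ring, hη, one_mul]

end NonvanishingCentralCoeff

section MotzkinDensity

variable {p : ℕ} [Fact p.Prime] {a b : ℤ}

theorem motzkinFactor_one (hT : ∀ n < p, centralCoeff (a : ZMod p) (b : ZMod p) n ≠ 0)
    (hp2 : 2 < p) (ha : (a : ZMod p) ≠ 0) :
    motzkinFactor (a : ZMod p) (b : ZMod p) 1 = ((1 - zeroDensityFormula p a b : ℝ) : ℂ) := by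
  have hfirst := linearFormCharSum_one_eq_sub_ncard (a := (a : ZMod p)) (b := b)
    (centralCoeff_sub_one_mul_self hT)
  have hsecond := linearFormCharSum_one_eq_sub_ncard (a := (a : ZMod p)) (b := b) (one_mul 1)
  simp only [one_mul, mul_one] at hsecond
  have hunit : IsUnit (2 * (a : ZMod p) ^ 2)⁻¹ :=
    isUnit_iff_ne_zero.2 (inv_ne_zero (two_mul_sq_ne_zero hp2 ha))
  have hp0 : (p : ℂ) ≠ 0 := by exact_mod_cast hp2.pos.ne'
  have hp1 : (p : ℂ) - 1 ≠ 0 := sub_ne_zero.2 (by exact_mod_cast (by lia : p ≠ 1))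
  have hp3 : (p : ℂ) + 1 ≠ 0 := by exact_mod_cast p.succ_ne_zero
  rw [motzkinFactor, linearFormFactor_one_reflect hT, linearFormFactor, hfirst, hsecond,
    sum_one_char_eq_sub_ncard, MulChar.one_apply hunit, zeroDensityFormula,
    Nat.cast_sub hp2.le, Nat.cast_pred hp2.pos]
  simp only [intCast_motzkin, intCast_centralTrinomial]
  push_cast
  field_simp
  ring

theorem motzkinCoeff_zero_left {R : Type*} [CommRing R] (b : R) (n : ℕ) :
    motzkinCoeff 0 b n = centralCoeff 0 b n := by
  rw [motzkinCoeff, trinomialCoeff_zero_left b n two_ne_zero, sub_zero, centralCoeff]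

theorem motzkinDensity_zero_iff (d : ℝ) :
    MotzkinDensity p a b 0 d ↔ HasMean (fun n =>
      (1 : DirichletCharacter ℂ p) (motzkinCoeff (a : ZMod p) (b : ZMod p) n))
        ((1 - d : ℝ) : ℂ) := by
  simp only [MotzkinDensity, intCast_motzkin]
  exact hasAsymptoticDensity_eq_zero_iff _ d

theorem motzkinDensity_zero_one (hT : ∃ n < p, centralCoeff (a : ZMod p) (b : ZMod p) n = 0) :
    MotzkinDensity p a b 0 1 := by
  obtain ⟨m, hm, hm0⟩ := hT
  have h := (hasAsymptoticDensity_motzkinCoeff_ne_zero hm hm0).compl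
  simpa [MotzkinDensity, intCast_motzkin, Set.compl_ofPred] using h

theorem exists_motzkinDensity_zero
    (hT : ∀ n < p, centralCoeff (a : ZMod p) (b : ZMod p) n ≠ 0) (hp2 : 2 < p) :
    ∃ D₀ : ℝ, MotzkinDensity p a b 0 D₀ ∧ (¬(p : ℤ) ∣ a → D₀ = zeroDensityFormula p a b) := by
  have hT1 : HasMean (fun n =>
      (1 : DirichletCharacter ℂ p) (centralCoeff (a : ZMod p) (b : ZMod p) n)) 1 := by
    simpa only [MulChar.one_apply (isUnit_iff_ne_zero.2 (centralCoeff_ne_zero hT _))] using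
      hasMean_const (1 : ℂ)
  rw [← ZMod.intCast_zmod_eq_zero_iff_dvd]
  rcases eq_or_ne (a : ZMod p) 0 with ha | ha
  · refine ⟨0, (motzkinDensity_zero_iff 0).2 ?_, fun h => absurd ha h⟩
    simpa [ha, motzkinCoeff_zero_left] using hT1
  · refine ⟨_, (motzkinDensity_zero_iff _).2 ?_, fun _ => rfl⟩
    simpa [motzkinFactor_one hT hp2 ha] using hasMean_char_motzkinCoeff hT hp2 ha 1 hT1

theorem hasMean_char_motzkinCoeff_zero {a b : ZMod p} (hT : ∀ n < p, centralCoeff a b n ≠ 0)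
    (hp2 : 2 < p)
    (hgen : Subgroup.closure {u : (ZMod p)ˣ | ∃ n < p, (u : ZMod p) = centralCoeff a b n} = ⊤)
    {χ : DirichletCharacter ℂ p} (hχ : χ ≠ 1) : HasMean (fun n => χ (motzkinCoeff a b n)) 0 := by
  obtain ⟨m, hm, hχm⟩ : ∃ m < p, χ (centralCoeff a b m) ≠ 1 := by
    contrapose! hχ
    refine mulChar_eq_one_of_closure_eq_top hgen ?_
    rintro u ⟨n, hn, hu⟩
    rw [hu, hχ n hn]
  have hcentral : HasMean (fun n => χ (centralCoeff a b n)) 0 :=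
    hasMean_char_zero_of_mul_digits χ (centralCoeff_zero a b)
      (fun n _ hr => centralCoeff_mul_add a b n hr) hm hχm
  rcases eq_or_ne a 0 with rfl | ha
  · simpa only [motzkinCoeff_zero_left] using hcentral
  · simpa only [mul_zero] using hasMean_char_motzkinCoeff hT hp2 ha χ hcentral

theorem motzkinDensity_of_motzkinDensity_zero
    (hT : ∀ n < p, centralCoeff (a : ZMod p) (b : ZMod p) n ≠ 0) (hp2 : 2 < p) {D₀ : ℝ}
    (hD : MotzkinDensity p a b 0 D₀)
    (hgen : Subgroup.closure
      {u : (ZMod p)ˣ | ∃ n < p, (u : ZMod p) = centralCoeff (a : ZMod p) (b : ZMod p) n} = ⊤)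
    {k : ZMod p} (hk : k ≠ 0) : MotzkinDensity p a b k ((1 - D₀) / (p - 1)) := by
  have hp : p.Prime := Fact.out
  have h := hasAsymptoticDensity_of_hasMean_char ((motzkinDensity_zero_iff D₀).1 hD)
    (fun χ hχ => hasMean_char_motzkinCoeff_zero hT hp2 hgen hχ) hk.isUnit
  rw [Nat.totient_prime hp, Nat.cast_pred hp.pos] at h
  simpa only [MotzkinDensity, intCast_motzkin] using h

end MotzkinDensity

theorem mainTheorem1 (p : ℕ) (hp : p.Prime) (a b : ℤ) :
    ((∃ n < p, (centralTrinomial a b n : ZMod p) = 0) → MotzkinDensity p a b 0 1) ∧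
    ((∀ n < p, (centralTrinomial a b n : ZMod p) ≠ 0) → 2 < p →
      ∃ D₀ : ℝ, MotzkinDensity p a b 0 D₀ ∧
        (¬ (p : ℤ) ∣ a → D₀ = zeroDensityFormula p a b) ∧
        (Subgroup.closure {u : (ZMod p)ˣ | ∃ n < p, (u : ZMod p) = centralTrinomial a b n} = ⊤ →
          ∀ k : ZMod p, k ≠ 0 → MotzkinDensity p a b k ((1 - D₀) / ((p : ℝ) - 1)))) := by
  have : Fact p.Prime := ⟨hp⟩
  simp only [intCast_centralTrinomial]
  refine ⟨motzkinDensity_zero_one, fun hT hp2 => ?_⟩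
  obtain ⟨D₀, hD, hformula⟩ := exists_motzkinDensity_zero hT hp2
  exact ⟨D₀, hD, hformula, fun hgen k hk =>
    motzkinDensity_of_motzkinDensity_zero hT hp2 hD hgen hk⟩
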